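/- **Conventions.** Let $I=[0,1]$; path spaces $X^I$ carry the compact-open topology (for a metric space $X$, the topology of the sup metric). For a metric space $X$ and $k\ge 1$, let $\mathcal B_k(X)$ be the space of probability measures on $X$ supported on at most $k$ points, $\mu=\sum a_i x_i$, with the Lévy–Prokhorov metric; $\operatorname{supp}(\mu)$ is the set of points of positive mass. Invariants below take values in $\{0,1,2,\dots\}\cup\{\infty\}$, the value being $\infty$ if no integer $n$ as required exists, and $(\infty+1)^2-1=\infty$. Fix an integer $r\ge 2$ and put $t_i=\frac{i-1}{r-1}$ for $1\le i\le r$. *Parametrized complexity.* For a map $p\colon E\to B$ with $E$ a metric space, let $E^r_B=\{(e_1,\dots,e_r)\in E^r : p(e_i)=p(e_j)\ \text{for all } i,j\}$ and let $E^I_B\subset E^I$ be the subspace of paths lying in a single fiber of $p$. Then $\mathrm{dTC}_r[p\colon E\to B]$ is the smallest integer $n\ge 0$ for which there is a continuous map $s\colon E^r_B\to\mathcal B_{n+1}(E^I_B)$ such that, for every $(e_1,\dots,e_r)\in E^r_B$, every path $\gamma\in\operatorname{supp}\, s(e_1,\dots,e_r)$ satisfies $\gamma(t_i)=e_i$ for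 all $i$. *Equivariant complexity.* Let $G$ be a topological group and $F$ a metric space with a continuous $G$-action. Let $G$ act diagonally on $F^r$, pointwise on $F^I$, and by push-forward, $g\cdot\sum a_\phi\phi=\sum a_\phi\, g\phi$, on $\mathcal B_k(F^I)$. Then $\mathrm{dTC}_{G,r}(F)$ is the smallest integer $n\ge 0$ for which there is a continuous $G$-equivariant map $s\colon F^r\to\mathcal B_{n+1}(F^I)$ such that, for every $(f_1,\dots,f_r)\in F^r$, every path $\phi\in\operatorname{supp}\, s(f_1,\dots,f_r)$ satisfies $\phi(t_i)=f_i$ for all $i$. **Theorem.** Let $G$ be a topological group, let $q\colon P\to B$ be a (locally trivial) principal $G$-bundle, so that $B=P/G$, and let $F$ be a metric space with a continuous $G$-action. Let $E=F\times_G P=(F\times P)/G$ be the orbit space of the diagonal action, assume that its topology is induced by a metric, and fix such a metric. Let $p\colon E=F\times_G P\to P/G=B$, $p([f,y])=q(y)$, be the associated bundle with fiber $F$ and structure group $G$. Then for every $r\ge 2$, $$\mathrm{dTC}_r[p\colon F\times_G P\to P/G]\;\le\;\bigl(\mathrm{dTC}_{G,r}(F)+1\bigr)^2-1 .$$ -/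

import Mathlib

open MeasureTheory Topology
open scoped unitInterval

namespace DistTC

/-- The Borel σ-algebra on a path space `C(I, X)` (compact-open topology, which for a metric
space `X` is the topology of the sup metric). -/
instance instMeasurableSpacePath {X : Type*} [TopologicalSpace X] :
    MeasurableSpace C(I, X) := borel _

instance instBorelSpacePath {X : Type*} [TopologicalSpace X] : BorelSpace C(I, X) := ⟨rfl⟩

/-- `DistMeasure k X` is the space `𝓑ₖ(X)` of probability measures on the metric space `X` that
are supported on at most `k` points, with the topology of the Lévy–Prokhorov metric. -/
abbrev DistMeasure (k : ℕ) (X : Type*) [MetricSpace X] [MeasurableSpace X] [BorelSpace X] :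
    Type _ :=
  {μ : LevyProkhorov (ProbabilityMeasure X) //
    ∃ S : Finset X, S.card ≤ k ∧ (μ.toMeasure : Measure X) (S : Set X)ᶜ = 0}

/-- The support of a finitely supported measure `∑ aᵢ xᵢ`: the points of positive mass. -/
def DistMeasure.supp {k : ℕ} {X : Type*} [MetricSpace X] [MeasurableSpace X] [BorelSpace X]
    (μ : DistMeasure k X) : Set X :=
  {x | (μ.1.toMeasure : Measure X) {x} ≠ 0}

/-- The push-forward action `g • ∑ aᵢ xᵢ = ∑ aᵢ (g • xᵢ)` on `𝓑ₖ(X)`. -/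
noncomputable instance DistMeasure.instSMul {G : Type*} [Group G] {k : ℕ} {X : Type*}
    [MetricSpace X] [MeasurableSpace X] [BorelSpace X] [MulAction G X] [ContinuousConstSMul G X] :
    SMul G (DistMeasure k X) where
  smul g μ :=
    ⟨LevyProkhorov.ofMeasure
      (μ.1.toMeasure.map (f := fun x : X => g • x)
        (continuous_const_smul g).measurable.aemeasurable), by
      classical
      obtain ⟨S, hS, h0⟩ := μ.2
      refine ⟨S.image (fun x => g • x), Finset.card_image_le.trans hS, ?_⟩
      have hm : MeasurableSet (((S.image (fun x => g • x) : Finset X) : Set X)ᶜ) :=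
        (Finset.measurableSet _).compl
      rw [ProbabilityMeasure.toMeasure_map,
        Measure.map_apply (continuous_const_smul g).measurable hm]
      refine measure_mono_null ?_ h0
      intro x hx hxS
      exact hx (Finset.mem_coe.2 (Finset.mem_image_of_mem (fun x => g • x) (Finset.mem_coe.1 hxS)))⟩

/-- `s : Y → 𝓑ₖ(X)` is a continuous section of `𝓑ₖ(p)`, that is, the measure `s y` is supported
in the fibre `p ⁻¹(y)` for every `y`. -/
def IsDistSection {k : ℕ} {X Y : Type*} [MetricSpace X] [MeasurableSpace X] [BorelSpace X]
    [TopologicalSpace Y] (p : X → Y) (s : C(Y, DistMeasure k X)) : Prop :=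
  ∀ y, (s y).supp ⊆ p ⁻¹' {y}

/-- The equivariant distributional sectional category of a `G`-map `p : X → Y`: the smallest `n`
such that `𝓑ₙ₊₁(p)` has a `G`-equivariant section (`⊤` if there is no such `n`). -/
noncomputable def dsecatG (G : Type*) [Group G] {X Y : Type*} [MetricSpace X] [MeasurableSpace X]
    [BorelSpace X] [MulAction G X] [ContinuousConstSMul G X] [TopologicalSpace Y] [MulAction G Y]
    (p : X → Y) : ℕ∞ :=
  sInf {N : ℕ∞ | ∃ n : ℕ, N = n ∧ ∃ s : C(Y, DistMeasure (n + 1) X),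
    IsDistSection p s ∧ ∀ (g : G) (y : Y), s (g • y) = g • s y}

/-- The time `i / (r - 1)`, where `i` runs through `0, …, r - 1`. -/
noncomputable def seqTime (r : ℕ) (i : Fin r) : I :=
  ⟨(i : ℝ) / ((r : ℝ) - 1), by
    have h : ((i : ℕ) : ℝ) + 1 ≤ r := by exact_mod_cast i.2
    have h0 : (0 : ℝ) ≤ ((i : ℕ) : ℝ) := Nat.cast_nonneg _
    exact unitInterval.div_mem h0 (by linarith) (by linarith)⟩

/-- The path fibration `π_r : X^I → X^r`, `φ ↦ (φ (i / (r - 1)))ᵢ`. -/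
noncomputable def pathEval (r : ℕ) (X : Type*) [TopologicalSpace X] (φ : C(I, X)) : Fin r → X :=
  fun i => φ (seqTime r i)

/-- The `r`-th sequential equivariant distributional complexity of a `G`-space `F`.  The group
acts on paths pointwise and on `F^r` diagonally. -/
noncomputable def equivariantDTC (G : Type*) [Group G] (r : ℕ) (F : Type*) [MetricSpace F]
    [MulAction G F] [ContinuousConstSMul G F] : ℕ∞ :=
  dsecatG G (pathEval r F)

/-- The space `E^I_B` of paths in `E` that lie in a single fibre of `p`. -/
abbrev FiberPath {E B : Type*} [TopologicalSpace E] (p : E → B) : Type _ :=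
  {γ : C(I, E) // ∃ b : B, ∀ t, p (γ t) = b}

/-- The fibre product `E^r_B`. -/
abbrev FiberProd {E B : Type*} (r : ℕ) (p : E → B) : Type _ :=
  {e : Fin r → E // ∀ i j, p (e i) = p (e j)}

/-- The set `E^I_B(e₁, …, e_r)` of fibrewise paths that pass through the points `eᵢ` at the
prescribed times. -/
def fiberPathsThrough {E B : Type*} [TopologicalSpace E] {r : ℕ} {p : E → B} (e : FiberProd r p) :
    Set (FiberPath p) :=
  {γ | ∀ i, γ.1 (seqTime r i) = e.1 i}

/-- An `r`-th sequential parametrized `k`-distributed navigation algorithm for `p : E → B`. -/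
def IsNavigationAlgorithm {E B : Type*} [MetricSpace E] {r k : ℕ} {p : E → B}
    (s : C(FiberProd r p, DistMeasure k (FiberPath p))) : Prop :=
  ∀ e, (s e).supp ⊆ fiberPathsThrough e

/-- The `r`-th sequential parametrized distributional complexity `dTC_r[p : E → B]`: the smallest
`n` such that `p` has an `r`-th sequential parametrized `(n+1)`-distributed navigation algorithm
(`⊤` if there is no such `n`). -/
noncomputable def parametrizedDTC {E B : Type*} [MetricSpace E] (r : ℕ) (p : E → B) : ℕ∞ :=
  sInf {N : ℕ∞ | ∃ n : ℕ, N = n ∧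
    ∃ s : C(FiberProd r p, DistMeasure (n + 1) (FiberPath p)), IsNavigationAlgorithm s}

/-- `q : P → B` is a (locally trivial) principal `G`-bundle: `G` acts along the fibres of `q` and
`q` has local trivializations `q ⁻¹(U) ≅ U × G` that are `G`-equivariant, where `G` acts on itself
by translation. -/
structure IsPrincipalBundle (G : Type*) [Group G] [TopologicalSpace G] {P B : Type*}
    [TopologicalSpace P] [TopologicalSpace B] [MulAction G P] (q : P → B) : Prop where
  proj_smul : ∀ (g : G) (y : P), q (g • y) = q y
  exists_trivialization : ∀ b : B, ∃ e : Bundle.Trivialization G q, b ∈ e.baseSet ∧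
    ∀ (g : G), ∀ y ∈ e.source, (e (g • y)).2 = g * (e y).2

/-- The associated space `F ×_G P`, the orbit space of the diagonal action on `F × P` (with the
quotient topology). -/
abbrev AssociatedSpace (G F P : Type*) [Group G] [MulAction G F] [MulAction G P] : Type _ :=
  MulAction.orbitRel.Quotient G (F × P)

/-- The class `[f, y]` in `F ×_G P`. -/
def AssociatedSpace.mk (G : Type*) {F P : Type*} [Group G] [MulAction G F] [MulAction G P]
    (f : F) (y : P) : AssociatedSpace G F P :=
  Quotient.mk (MulAction.orbitRel G (F × P)) (f, y)

end DistTC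

/-!
The fibre product is itself an associated bundle, `E^r_B = F^r ×_G P`: if `[fᵢ, yᵢ]` all lie over
the same point, the translations `gᵢ` with `gᵢ • y₀ = yᵢ` depend continuously on the data, and
`[fᵢ, yᵢ] = [gᵢ⁻¹ • fᵢ, y₀]`. Given a `G`-equivariant section `s : F^r → 𝓑ₖ(F^I)`, pushing `s f`
forward along `φ ↦ [φ, y]` gives a continuous `G`-invariant function of `(f, y) ∈ F^r × P`, which
therefore descends to a navigation algorithm on `E^r_B` with the same number of points. This proves
the sharper bound `dTC_r[p] ≤ dTC_{G,r}(F)`.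
-/

open Filter Function Metric Set

namespace DistTC

section FiniteFamily

variable {W X Y : Type*} [TopologicalSpace W] [PseudoMetricSpace X] [PseudoMetricSpace Y]

theorem eventually_forall_mem_ball_dist_lt {Φ : W × X → Y} {w₀ : W} {S : Set X} (hS : S.Finite)
    (hΦ : ∀ x ∈ S, ContinuousAt Φ (w₀, x)) {ε : ℝ} (hε : 0 < ε) :
    ∀ᶠ η in 𝓝[>] (0 : ℝ), ∀ᶠ w in 𝓝 w₀, ∀ x ∈ S, ∀ z ∈ ball x η,
      dist (Φ (w, z)) (Φ (w₀, x)) < ε := by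
  simp only [hS.eventually_all]
  intro x hx
  have hnear : ∀ᶠ a in 𝓝 w₀ ×ˢ 𝓝 x, dist (Φ a) (Φ (w₀, x)) < ε := by
    rw [← nhds_prod_eq]
    exact (hΦ x hx).eventually (ball_mem_nhds _ hε)
  obtain ⟨V, hV, U, hU, hVU⟩ := eventually_prod_iff.1 hnear
  obtain ⟨δ, hδ, hball⟩ := eventually_nhds_iff_ball.1 hU
  filter_upwards [Ioo_mem_nhdsGT hδ] with η hη
  filter_upwards [hV] with w hw z hz
  exact hVU hw (hball z (ball_subset_ball hη.2.le hz))

end FiniteFamily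

namespace DistMeasure

variable {k : ℕ} {X Y Z : Type*} [MetricSpace X] [MeasurableSpace X] [BorelSpace X]
  [MetricSpace Y] [MeasurableSpace Y] [BorelSpace Y]
  [MetricSpace Z] [MeasurableSpace Z] [BorelSpace Z]

theorem ext {μ ν : DistMeasure k X}
    (h : (μ.1.toMeasure : Measure X) = (ν.1.toMeasure : Measure X)) : μ = ν :=
  Subtype.ext (LevyProkhorov.toMeasure_injective (ProbabilityMeasure.toMeasure_injective h))

theorem finite_supp (μ : DistMeasure k X) : μ.supp.Finite := by
  obtain ⟨S, -, hS⟩ := μ.2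
  refine S.finite_toSet.subset fun x hx => ?_
  by_contra hxS
  exact hx (measure_mono_null (singleton_subset_iff.2 hxS) hS)

theorem ae_mem_supp (μ : DistMeasure k X) :
    ∀ᵐ x ∂(μ.1.toMeasure : Measure X), x ∈ μ.supp := by
  obtain ⟨S, -, hS⟩ := μ.2
  have hne : ∀ᵐ x ∂(μ.1.toMeasure : Measure X), ∀ z ∈ S, z ∉ μ.supp → x ≠ z := by
    refine S.eventually_all.2 fun z _ => eventually_imp_distrib_left.2 fun hz => ?_
    exact measure_eq_zero_iff_ae_notMem.1 (not_not.1 hz)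
  filter_upwards [hne, mem_ae_iff.2 hS] with x hx hxS
  by_contra hxμ
  exact hx x hxS hxμ rfl

/-- The push-forward `∑ aᵢ xᵢ ↦ ∑ aᵢ f(xᵢ)` of finitely supported measures along a continuous
map `f`, denoted `𝓑ₖ(f)` in the literature. -/
noncomputable def map (f : C(X, Y)) (μ : DistMeasure k X) : DistMeasure k Y :=
  ⟨LevyProkhorov.ofMeasure (μ.1.toMeasure.map (f := f) f.continuous.measurable.aemeasurable), by
    classical
    obtain ⟨S, hS, hSμ⟩ := μ.2
    refine ⟨S.image f, Finset.card_image_le.trans hS, ?_⟩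
    rw [ProbabilityMeasure.toMeasure_map,
      Measure.map_apply f.continuous.measurable (Finset.measurableSet _).compl]
    exact measure_mono_null (fun x hx hxS => hx (Finset.mem_image_of_mem f hxS)) hSμ⟩

theorem toMeasure_map (f : C(X, Y)) (μ : DistMeasure k X) :
    ((map f μ).1.toMeasure : Measure Y) = (μ.1.toMeasure : Measure X).map f :=
  ProbabilityMeasure.toMeasure_map _ f.continuous.measurable.aemeasurable

theorem map_map (g : C(Y, Z)) (f : C(X, Y)) (μ : DistMeasure k X) :
    map g (map f μ) = map (g.comp f) μ := by
  apply ext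
  simp only [toMeasure_map, ContinuousMap.coe_comp]
  exact Measure.map_map g.continuous.measurable f.continuous.measurable

theorem map_smul {G : Type*} [Group G] [MulAction G X] [ContinuousConstSMul G X]
    (f : C(X, Y)) (g : G) (μ : DistMeasure k X) :
    map f (g • μ) = map (f.comp ⟨(g • ·), continuous_const_smul g⟩) μ :=
  map_map f ⟨(g • ·), continuous_const_smul g⟩ μ

theorem supp_map_subset (f : C(X, Y)) (μ : DistMeasure k X) : (map f μ).supp ⊆ f '' μ.supp := by
  intro y hy
  have hmass : (μ.1.toMeasure : Measure X) (f ⁻¹' {y}) ≠ 0 := by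
    rwa [← Measure.map_apply f.continuous.measurable (measurableSet_singleton y),
      ← toMeasure_map]
  obtain ⟨x, hxy, hx⟩ :=
    ((frequently_ae_mem_iff.2 hmass).and_eventually μ.ae_mem_supp).exists
  exact ⟨x, hx, hxy⟩

theorem dist_map_le {f g : C(X, Y)} {μ ν : DistMeasure k X} {η ε : ℝ} (hμν : dist μ ν < η)
    (hηε : η ≤ ε) (hfg : ∀ x ∈ ν.supp, ∀ z ∈ ball x η, dist (f z) (g x) < ε) :
    dist (map f μ) (map g ν) ≤ ε := by
  have hη : 0 < η := dist_nonneg.trans_lt hμν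
  have hLP : levyProkhorovEDist (μ.1.toMeasure : Measure X) (ν.1.toMeasure : Measure X)
      < ENNReal.ofReal η := by
    rw [← LevyProkhorov.edist_probabilityMeasure_def, edist_dist]
    exact (ENNReal.ofReal_lt_ofReal_iff hη).2 hμν
  rw [Subtype.dist_eq, LevyProkhorov.dist_probabilityMeasure_def]
  refine levyProkhorovDist_le_of_forall_le _ _ (hη.le.trans hηε) fun ε' A hε' hA => ?_
  have hthick : ∀ᵐ x ∂(ν.1.toMeasure : Measure X),
      x ∈ thickening η (f ⁻¹' A) → x ∈ g ⁻¹' thickening ε' A := by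
    filter_upwards [ν.ae_mem_supp] with x hx hxA
    obtain ⟨z, hzA, hxz⟩ := mem_thickening_iff.1 hxA
    refine mem_thickening_iff.2 ⟨f z, hzA, ?_⟩
    rw [dist_comm]
    exact (hfg x hx z (mem_ball'.2 hxz)).trans hε'
  rw [toMeasure_map, toMeasure_map, Measure.map_apply f.continuous.measurable hA,
    Measure.map_apply g.continuous.measurable isOpen_thickening.measurableSet]
  calc (μ.1.toMeasure : Measure X) (f ⁻¹' A)
      ≤ (ν.1.toMeasure : Measure X) (thickening η (f ⁻¹' A)) + ENNReal.ofReal η := by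
        simpa only [ENNReal.toReal_ofReal hη.le] using
          left_measure_le_of_levyProkhorovEDist_lt hLP (f.continuous.measurable hA)
    _ ≤ (ν.1.toMeasure : Measure X) (g ⁻¹' thickening ε' A) + ENNReal.ofReal ε' :=
        add_le_add (measure_mono_ae hthick) (ENNReal.ofReal_le_ofReal (hηε.trans hε'.le))

theorem continuous_map_curry {W : Type*} [TopologicalSpace W] (Φ : C(W × X, Y)) :
    Continuous fun a : W × DistMeasure k X => map (Φ.curry a.1) a.2 := by
  rw [continuous_iff_continuousAt]
  rintro ⟨w₀, ν⟩
  refine Metric.tendsto_nhds.2 fun ε hε => ?_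
  obtain ⟨η, hclose, hη, hηε⟩ :=
    ((eventually_forall_mem_ball_dist_lt ν.finite_supp
      (fun x _ => Φ.continuous.continuousAt) (half_pos hε)).and
      (Ioo_mem_nhdsGT (half_pos hε))).exists
  rw [nhds_prod_eq]
  filter_upwards [hclose.prod_mk (ball_mem_nhds ν hη)]
  rintro ⟨w, μ⟩ ⟨hw, hμ⟩
  exact (dist_map_le (mem_ball.1 hμ) hηε.le hw).trans_lt (half_lt_self hε)

end DistMeasure

section FiberProd

variable {X E B : Type*} {r : ℕ}

/-- The map `X^r_B → E^r_B` of fibre products induced by a map `π : X → E` over `B`, where `X` is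
regarded as a space over `B` through `p ∘ π`. -/
def FiberProd.map (p : E → B) (π : X → E) (a : FiberProd r (p ∘ π)) : FiberProd r p :=
  ⟨fun i => π (a.1 i), a.2⟩

theorem FiberProd.isOpenQuotientMap_map [TopologicalSpace X] [TopologicalSpace E] (p : E → B)
    {π : X → E} (hπ : IsOpenQuotientMap π) :
    IsOpenQuotientMap (FiberProd.map (r := r) p π) :=
  (IsOpenQuotientMap.piMap fun _ => hπ).restrictPreimage {e | ∀ i j, p (e i) = p (e j)}

end FiberProd

namespace IsPrincipalBundle

variable {G P B : Type*} [Group G] [TopologicalSpace G] [TopologicalSpace P]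
  [TopologicalSpace B] [MulAction G P] {q : P → B}

theorem exists_smul_eq (hq : IsPrincipalBundle G q) {y y' : P} (h : q y = q y') :
    ∃ g : G, g • y = y' := by
  obtain ⟨T, hb, hT⟩ := hq.exists_trivialization (q y)
  have hy : y ∈ T.source := T.mem_source.2 hb
  have hy' : y' ∈ T.source := T.mem_source.2 (h ▸ hb)
  set g := (T y').2 * (T y).2⁻¹
  have hgy : g • y ∈ T.source := T.mem_source.2 (by rwa [hq.proj_smul])
  refine ⟨g, T.injOn hgy hy' (Prod.ext ?_ ?_)⟩
  · exact (T.coe_fst hgy).trans ((hq.proj_smul g y).trans (h.trans (T.coe_fst hy').symm))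
  · exact (hT g y hy).trans (inv_mul_cancel_right _ _)

theorem smul_left_injective (hq : IsPrincipalBundle G q) (y : P) :
    Injective fun g : G => g • y := by
  intro g g' hgg'
  obtain ⟨T, hb, hT⟩ := hq.exists_trivialization (q y)
  have hy : y ∈ T.source := T.mem_source.2 hb
  have hmul : g * (T y).2 = g' * (T y).2 := by
    rw [← hT g y hy, ← hT g' y hy]
    exact congrArg (fun z => (T z).2) hgg'
  exact mul_right_cancel hmul

theorem exists_continuous_translation [IsTopologicalGroup G] (hq : IsPrincipalBundle G q) :
    ∃ τ : C({a : P × P // q a.1 = q a.2}, G), ∀ a, τ a • a.1.1 = a.1.2 := by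
  choose τ hτ using fun a : {a : P × P // q a.1 = q a.2} => hq.exists_smul_eq a.2
  refine ⟨⟨τ, continuous_iff_continuousAt.2 fun a => ?_⟩, hτ⟩
  obtain ⟨T, hb, hT⟩ := hq.exists_trivialization (q a.1.1)
  have hfst : a.1.1 ∈ T.source := T.mem_source.2 hb
  have hsnd : a.1.2 ∈ T.source := T.mem_source.2 (a.2 ▸ hb)
  have hcont : ContinuousAt
      (fun c : {a : P × P // q a.1 = q a.2} => (T c.1.2).2 * (T c.1.1).2⁻¹) a := by
    have hcoord : ∀ v : C({a : P × P // q a.1 = q a.2}, P), v a ∈ T.source →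
        ContinuousAt (fun c => (T (v c)).2) a := fun v hv =>
      ((T.toOpenPartialHomeomorph.continuousAt hv).comp (v.continuousAt a)).snd
    exact (hcoord ⟨fun c => c.1.2, by fun_prop⟩ hsnd).mul
      (hcoord ⟨fun c => c.1.1, by fun_prop⟩ hfst).inv
  have hnear : ∀ᶠ c : {a : P × P // q a.1 = q a.2} in 𝓝 a, c.1.1 ∈ T.source :=
    (continuous_fst.comp continuous_subtype_val).continuousAt.eventually
      (T.open_source.mem_nhds hfst)
  refine hcont.congr (hnear.mono fun c hc => ?_)
  change (T c.1.2).2 * (T c.1.1).2⁻¹ = τ c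
  rw [← hτ c, hT _ _ hc, mul_inv_cancel_right]

end IsPrincipalBundle

/-- `π : F × P → E` exhibits `p : E → B` as the bundle with fibre `F` associated with the principal
bundle `q : P → B`: it identifies `E`, as a space over `B`, with the orbit space of the diagonal
action, so that `π (f, y)` plays the role of `[f, y]`. -/
structure IsAssociatedBundle (G : Type*) [Group G] {F P E B : Type*} [MulAction G F]
    [MulAction G P] [TopologicalSpace F] [TopologicalSpace P] [TopologicalSpace E]
    (q : P → B) (p : E → B) (π : F × P → E) : Prop where
  isOpenQuotientMap : IsOpenQuotientMap π
  apply_eq_apply_iff : ∀ a b, π a = π b ↔ ∃ g : G, g • a = b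
  proj_apply : ∀ a, p (π a) = q a.2

theorem isAssociatedBundle_of_homeomorph {G F P E B : Type*} [Group G] [MulAction G F]
    [MulAction G P] [TopologicalSpace F] [TopologicalSpace P] [TopologicalSpace E]
    [ContinuousConstSMul G F] [ContinuousConstSMul G P] {q : P → B} {p : E → B}
    (h : AssociatedSpace G F P ≃ₜ E)
    (hp : ∀ (f : F) (y : P), p (h (AssociatedSpace.mk G f y)) = q y) :
    IsAssociatedBundle G q p fun a : F × P => h (AssociatedSpace.mk G a.1 a.2) where
  isOpenQuotientMap := h.isOpenQuotientMap.comp MulAction.isOpenQuotientMap_quotientMk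
  apply_eq_apply_iff a b := by
    rw [h.injective.eq_iff, eq_comm]
    exact Quotient.eq
  proj_apply a := hp a.1 a.2

namespace IsAssociatedBundle

variable {G F P E B : Type*} [Group G] [MulAction G F] [MulAction G P]

section Topological

variable [TopologicalSpace F] [TopologicalSpace P] [TopologicalSpace E]
  {q : P → B} {p : E → B} {π : F × P → E}

theorem apply_smul (hπ : IsAssociatedBundle G q p π) (g : G) (a : F × P) : π (g • a) = π a :=
  ((hπ.apply_eq_apply_iff _ _).2 ⟨g, rfl⟩).symm

theorem apply_left_injective [TopologicalSpace G] [TopologicalSpace B]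
    (hπ : IsAssociatedBundle G q p π) (hq : IsPrincipalBundle G q) (y : P) :
    Injective fun f : F => π (f, y) := by
  intro f f' hff'
  obtain ⟨g, hg⟩ := (hπ.apply_eq_apply_iff _ _).1 hff'
  obtain ⟨hf, hy⟩ := Prod.mk.inj hg
  obtain rfl : g = 1 := hq.smul_left_injective y (hy.trans (one_smul G y).symm)
  exact (one_smul G f).symm.trans hf

/-- The map `F^r × P → E^r_B`, `(f, y) ↦ ([fᵢ, y])ᵢ`, which identifies `E^r_B` with
`F^r ×_G P`. -/
def fiberProdMap (hπ : IsAssociatedBundle G q p π) (r : ℕ) :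
    C((Fin r → F) × P, FiberProd r p) where
  toFun a := ⟨fun i => π (a.1 i, a.2), fun i j => by simp only [hπ.proj_apply]⟩
  continuous_toFun := by
    have hcont := hπ.isOpenQuotientMap.continuous
    fun_prop

theorem isQuotientMap_fiberProdMap [TopologicalSpace G] [IsTopologicalGroup G]
    [ContinuousSMul G F] [TopologicalSpace B] (hπ : IsAssociatedBundle G q p π)
    (hq : IsPrincipalBundle G q) (r : ℕ) [NeZero r] : IsQuotientMap (hπ.fiberProdMap r) := by
  have hcoord : ∀ i, Continuous fun a : FiberProd r (p ∘ π) => a.1 i := fun i =>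
    (continuous_apply i).comp continuous_subtype_val
  obtain ⟨τ, hτ⟩ : ∃ τ : Fin r → C(FiberProd r (p ∘ π), G),
      ∀ i a, τ i a • (a.1 0).2 = (a.1 i).2 := by
    obtain ⟨τ, hτ⟩ := hq.exists_continuous_translation
    have hfiber : ∀ (a : FiberProd r (p ∘ π)) i, q (a.1 0).2 = q (a.1 i).2 := fun a i => by
      rw [← hπ.proj_apply, ← hπ.proj_apply]
      exact a.2 0 i
    exact ⟨fun i => τ.comp ⟨fun a => ⟨((a.1 0).2, (a.1 i).2), hfiber a i⟩,
      ((hcoord 0).snd.prodMk (hcoord i).snd).subtype_mk _⟩, fun i a => hτ ⟨_, hfiber a i⟩⟩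
  let align : C(FiberProd r (p ∘ π), (Fin r → F) × P) :=
    ⟨fun a => (fun i => (τ i a)⁻¹ • (a.1 i).1, (a.1 0).2),
      (continuous_pi fun i => (τ i).continuous.inv.smul (hcoord i).fst).prodMk (hcoord 0).snd⟩
  have h_comp : hπ.fiberProdMap r ∘ align = FiberProd.map p π := by
    ext a i
    calc π ((τ i a)⁻¹ • (a.1 i).1, (a.1 0).2)
        = π (τ i a • ((τ i a)⁻¹ • (a.1 i).1, (a.1 0).2)) := (hπ.apply_smul _ _).symm
      _ = π (a.1 i) := by rw [Prod.smul_mk, smul_inv_smul, hτ]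
  refine IsQuotientMap.of_comp align.continuous (hπ.fiberProdMap r).continuous ?_
  rw [h_comp]
  exact (FiberProd.isOpenQuotientMap_map p hπ.isOpenQuotientMap).isQuotientMap

theorem exists_smul_eq_of_fiberProdMap_eq [TopologicalSpace G] [TopologicalSpace B]
    (hπ : IsAssociatedBundle G q p π) (hq : IsPrincipalBundle G q) {r : ℕ} [NeZero r]
    {a b : (Fin r → F) × P} (hab : hπ.fiberProdMap r a = hπ.fiberProdMap r b) :
    ∃ g : G, g • a = b := by
  have hcoord : ∀ i, π (a.1 i, a.2) = π (b.1 i, b.2) := fun i =>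
    congrFun (congrArg Subtype.val hab) i
  obtain ⟨g, hg⟩ := (hπ.apply_eq_apply_iff _ _).1 (hcoord 0)
  have hy : g • a.2 = b.2 := congrArg Prod.snd hg
  refine ⟨g, Prod.ext (funext fun i => hπ.apply_left_injective hq b.2 ?_) hy⟩
  calc π (g • a.1 i, b.2) = π (g • (a.1 i, a.2)) := by rw [Prod.smul_mk, hy]
    _ = π (b.1 i, b.2) := (hπ.apply_smul g _).trans (hcoord i)

/-- The map `P × F^I → E^I_B` sending `(y, φ)` to the path `t ↦ [φ t, y]` in the fibre over
`q y`. -/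
def fiberPathMap (hπ : IsAssociatedBundle G q p π) : C(P × C(I, F), FiberPath p) where
  toFun a := ⟨⟨fun t => π (a.2 t, a.1), by
    have hcont := hπ.isOpenQuotientMap.continuous
    fun_prop⟩, q a.1, fun _ => hπ.proj_apply _⟩
  continuous_toFun := by
    have hcont := hπ.isOpenQuotientMap.continuous
    refine Continuous.subtype_mk (ContinuousMap.continuous_of_continuous_uncurry _ ?_) _
    change Continuous fun c : (P × C(I, F)) × I => π (c.1.2 c.2, c.1.1)
    fun_prop

theorem fiberPathMap_smul [ContinuousConstSMul G F] (hπ : IsAssociatedBundle G q p π) (g : G)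
    (a : P × C(I, F)) : hπ.fiberPathMap (g • a) = hπ.fiberPathMap a :=
  Subtype.ext (ContinuousMap.ext fun t => hπ.apply_smul g (a.2 t, a.1))

end Topological

section Metric

variable [MetricSpace F] [TopologicalSpace P] [MetricSpace E]
  {q : P → B} {p : E → B} {π : F × P → E} {r k : ℕ}

/-- The distribution over the paths `t ↦ [φ t, y]` in the fibre over `q y`, where `φ` is
distributed according to `s f`. -/
noncomputable def pathDistribution (hπ : IsAssociatedBundle G q p π)
    (s : C(Fin r → F, DistMeasure k C(I, F))) :
    C((Fin r → F) × P, DistMeasure k (FiberPath p)) where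
  toFun a := DistMeasure.map (hπ.fiberPathMap.curry a.2) (s a.1)
  continuous_toFun := (DistMeasure.continuous_map_curry hπ.fiberPathMap).comp
    (continuous_snd.prodMk (s.continuous.comp continuous_fst))

theorem pathDistribution_smul [ContinuousConstSMul G F] (hπ : IsAssociatedBundle G q p π)
    {s : C(Fin r → F, DistMeasure k C(I, F))} (hs : ∀ (g : G) f, s (g • f) = g • s f)
    (g : G) (a : (Fin r → F) × P) :
    hπ.pathDistribution s (g • a) = hπ.pathDistribution s a := by
  change DistMeasure.map _ (s (g • a.1)) = DistMeasure.map _ (s a.1)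
  rw [hs, DistMeasure.map_smul]
  congr 1
  ext1 φ
  exact hπ.fiberPathMap_smul g (a.2, φ)

theorem supp_pathDistribution_subset (hπ : IsAssociatedBundle G q p π)
    {s : C(Fin r → F, DistMeasure k C(I, F))} (hs : IsDistSection (pathEval r F) s)
    (a : (Fin r → F) × P) :
    (hπ.pathDistribution s a).supp ⊆ fiberPathsThrough (hπ.fiberProdMap r a) := by
  intro γ hγ i
  obtain ⟨φ, hφ, rfl⟩ := DistMeasure.supp_map_subset _ _ hγ
  have hφi : φ (seqTime r i) = a.1 i := congrFun (hs a.1 hφ) i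
  exact congrArg (fun x => π (x, a.2)) hφi

variable [TopologicalSpace G] [IsTopologicalGroup G] [ContinuousSMul G F] [TopologicalSpace B]

theorem exists_isNavigationAlgorithm [NeZero r] (hπ : IsAssociatedBundle G q p π)
    (hq : IsPrincipalBundle G q) {s : C(Fin r → F, DistMeasure k C(I, F))}
    (hsec : IsDistSection (pathEval r F) s) (hs : ∀ (g : G) f, s (g • f) = g • s f) :
    ∃ S : C(FiberProd r p, DistMeasure k (FiberPath p)), IsNavigationAlgorithm S := by
  have hquot := hπ.isQuotientMap_fiberProdMap hq r
  have hfactor : FactorsThrough (hπ.pathDistribution s) (hπ.fiberProdMap r) := by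
    intro a b hab
    obtain ⟨g, rfl⟩ := hπ.exists_smul_eq_of_fiberProdMap_eq hq hab
    exact (hπ.pathDistribution_smul hs g a).symm
  refine ⟨hquot.lift (hπ.pathDistribution s) hfactor, fun e => ?_⟩
  obtain ⟨a, rfl⟩ := hquot.surjective e
  have hlift : hquot.lift (hπ.pathDistribution s) hfactor (hπ.fiberProdMap r a) =
      hπ.pathDistribution s a :=
    DFunLike.congr_fun (hquot.lift_comp (hπ.pathDistribution s) hfactor) a
  rw [hlift]
  exact hπ.supp_pathDistribution_subset hsec a

theorem parametrizedDTC_le [NeZero r] (hπ : IsAssociatedBundle G q p π)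
    (hq : IsPrincipalBundle G q) : parametrizedDTC r p ≤ equivariantDTC G r F := by
  refine le_sInf ?_
  rintro _ ⟨n, rfl, s, hsec, hs⟩
  exact sInf_le ⟨n, rfl, hπ.exists_isNavigationAlgorithm hq hsec hs⟩

end Metric

end IsAssociatedBundle

theorem le_add_one_sq_sub_one (n : ℕ∞) : n ≤ (n + 1) ^ 2 - 1 :=
  ENat.le_sub_of_add_le_right ENat.one_ne_top (le_self_pow₀ le_add_self two_ne_zero)

end DistTC

theorem mainTheorem7_general {G F P E B : Type*}
    [Group G] [TopologicalSpace G] [IsTopologicalGroup G]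
    [MetricSpace F] [MulAction G F] [ContinuousSMul G F]
    [TopologicalSpace P] [MulAction G P] [ContinuousConstSMul G P]
    [TopologicalSpace B] [MetricSpace E]
    (q : P → B) (hq : DistTC.IsPrincipalBundle G q)
    (p : E → B) (h : DistTC.AssociatedSpace G F P ≃ₜ E)
    (hp : ∀ (f : F) (y : P), p (h (DistTC.AssociatedSpace.mk G f y)) = q y)
    (r : ℕ) (hr : 2 ≤ r) :
    DistTC.parametrizedDTC r p ≤ DistTC.equivariantDTC G r F := by
  have : NeZero r := ⟨by omega⟩
  exact (DistTC.isAssociatedBundle_of_homeomorph h hp).parametrizedDTC_le hq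

theorem mainTheorem7 {G F P E B : Type*}
    [Group G] [TopologicalSpace G] [IsTopologicalGroup G]
    [MetricSpace F] [MulAction G F] [ContinuousSMul G F]
    [TopologicalSpace P] [MulAction G P] [ContinuousSMul G P]
    [TopologicalSpace B] [MetricSpace E]
    (q : P → B) (hq : DistTC.IsPrincipalBundle G q)
    (p : E → B) (h : DistTC.AssociatedSpace G F P ≃ₜ E)
    (hp : ∀ (f : F) (y : P), p (h (DistTC.AssociatedSpace.mk G f y)) = q y)
    (r : ℕ) (hr : 2 ≤ r) :
    DistTC.parametrizedDTC r p ≤ (DistTC.equivariantDTC G r F + 1) ^ 2 - 1 := by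
  exact (mainTheorem7_general q hq p h hp r hr).trans (DistTC.le_add_one_sq_sub_one _)
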